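/- Let $T,q>0$ and $x\in\mathbb{R}$. For $y\in\mathbb{R}$ let, under $\mathbb{P}_y$, the process $W=(W_t)_{t\ge 0}$ be a Brownian motion with continuous paths started at $y$ (that is, $W-y$ is a standard Brownian motion), regarded as a random element of $C([0,\infty))$ with the Borel $\sigma$-algebra of locally uniform convergence, and let $I_S:=\int_0^S W_s^2\,\mathrm{d}s$ for $S\ge 0$. Then $\mathbb{P}_x(I_T\le q^2T)>0$ and $\mathbb{P}_{x/q}(I_{T/q^2}\le T/q^2)>0$, and $$\mathbb{P}_x\Big(\tfrac1q\,(W_{q^2t})_{t\ge 0}\in\cdot\ \Big|\ I_T\le q^2T\Big)=\mathbb{P}_{x/q}\Big((W_t)_{t\ge 0}\in\cdot\ \Big|\ I_{T/q^2}\le T/q^2\Big)$$ as probability measures on $C([0,\infty))$. -/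

import Mathlib

open MeasureTheory ProbabilityTheory
open scoped NNReal

/-- The path space `C([0,∞))` of continuous real functions on `[0,∞)`, with its topology of
locally uniform convergence (the compact-open topology), carries its Borel σ-algebra. -/
noncomputable instance instMeasurableSpacePath : MeasurableSpace C(ℝ≥0, ℝ) :=
  borel C(ℝ≥0, ℝ)

instance instBorelSpacePath : BorelSpace C(ℝ≥0, ℝ) := ⟨rfl⟩

/-- `W`, a random element of `C([0,∞))`, is under `P` a Brownian motion started at `x`, i.e.
`W - x` is a standard Brownian motion. (That `P` is a probability measure is implied.) -/
structure IsBrownianFrom {Ω : Type*} [MeasurableSpace Ω] (x : ℝ) (W : Ω → C(ℝ≥0, ℝ))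
    (P : Measure Ω) : Prop where
  aemeasurable : AEMeasurable W P
  isBrownianReal : IsBrownianReal (fun (t : ℝ≥0) (ω : Ω) => W ω t - x) P

/-- The functional `I_T(w) = ∫₀ᵀ w(s)² ds` of a path `w`. -/
noncomputable def energy (T : ℝ) (w : C(ℝ≥0, ℝ)) : ℝ :=
  ∫ s in (0 : ℝ)..T, (w s.toNNReal) ^ 2

/-- The rescaled path `t ↦ q⁻¹ w(q² t)`. -/
noncomputable def rescale (q : ℝ) (w : C(ℝ≥0, ℝ)) : C(ℝ≥0, ℝ) where
  toFun t := q⁻¹ * w (Real.toNNReal (q ^ 2 * (t : ℝ)))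
  continuous_toFun := by fun_prop

open Set Topology

/-! The identity is Brownian scaling: the rescaled `W` and `W'` have the same finite-dimensional
laws, hence the same law on path space, and `energy_rescale` turns both conditioning events into
preimages of one path event. Positivity takes more work because `x` may be far from 0.
`measure_forall_abs_le_pos` gives small-ball positivity for a standard Brownian motion.
`indepFun_sub_proj` makes its value at `δ` independent of the remainder, so the path can be steered
near 0 by time `δ` while the remainder stays small. A small `δ` makes the energy spent before that
time negligible. -/

/-! ### Laws on path space -/

/-- Evaluation along a dense sequence of times identifies the Borel σ-algebra of path space. -/
theorem measurableEmbedding_eval_denseSeq :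
    MeasurableEmbedding fun (w : C(ℝ≥0, ℝ)) (n : ℕ) => w (TopologicalSpace.denseSeq ℝ≥0 n) := by
  -- Lusin–Souslin: a continuous injection of a Polish space is a measurable embedding.
  refine Continuous.measurableEmbedding (by fun_prop) fun w v h => ?_
  refine DFunLike.coe_injective ?_
  refine (TopologicalSpace.denseRange_denseSeq ℝ≥0).equalizer w.continuous v.continuous ?_
  exact h

/-- A finite measure on path space is determined by its finite-dimensional distributions. -/
theorem Measure.ext_path {μ ν : Measure C(ℝ≥0, ℝ)} [IsFiniteMeasure μ]
    (h : ∀ I : Finset ℝ≥0, μ.map (fun w => I.restrict (w ·)) = ν.map (fun w => I.restrict (w ·))) :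
    μ = ν := by
  have hm : Measurable fun (w : C(ℝ≥0, ℝ)) (t : ℝ≥0) => w t :=
    measurable_pi_lambda _ fun t => (continuous_eval_const t).measurable
  have key : μ.map (fun w t => w t) = ν.map (fun w t => w t) := by
    have h1 := isProjectiveLimit_map (P := μ) (X := fun t (w : C(ℝ≥0, ℝ)) => w t) hm.aemeasurable
    have h2 := isProjectiveLimit_map (P := ν) (X := fun t (w : C(ℝ≥0, ℝ)) => w t) hm.aemeasurable
    simp_rw [h] at h1
    have : ∀ I : Finset ℝ≥0, IsFiniteMeasure (ν.map fun w => I.restrict (w ·)) := fun I => by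
      rw [← h I]; infer_instance
    exact h1.unique h2
  have hd : Measurable fun (f : ℝ≥0 → ℝ) (n : ℕ) => f (TopologicalSpace.denseSeq ℝ≥0 n) := by
    fun_prop
  have key' := congrArg (Measure.map fun (f : ℝ≥0 → ℝ) (n : ℕ) =>
    f (TopologicalSpace.denseSeq ℝ≥0 n)) key
  rw [Measure.map_map hd hm, Measure.map_map hd hm] at key'
  have e := measurableEmbedding_eval_denseSeq
  rw [← e.comap_map μ, ← e.comap_map ν]
  exact congrArg _ key'

theorem measurable_restrict_path (I : Finset ℝ≥0) :
    Measurable fun w : C(ℝ≥0, ℝ) => I.restrict (w ·) :=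
  measurable_pi_lambda _ fun t => (continuous_eval_const (t : ℝ≥0)).measurable

/-- The law on path space of a continuous process that is a pre-Brownian motion up to a constant
is uniquely determined. -/
theorem map_eq_of_isPreBrownianReal {Ω Ω' : Type*} [MeasurableSpace Ω] [MeasurableSpace Ω']
    {P : Measure Ω} {P' : Measure Ω'} {x : ℝ} {W : Ω → C(ℝ≥0, ℝ)} {W' : Ω' → C(ℝ≥0, ℝ)}
    (hW : AEMeasurable W P) (hB : IsPreBrownianReal (fun t ω => W ω t - x) P)
    (hW' : AEMeasurable W' P') (hB' : IsPreBrownianReal (fun t ω => W' ω t - x) P') :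
    P.map W = P'.map W' := by
  have : IsProbabilityMeasure P := hB.isGaussianProcess.isProbabilityMeasure
  refine Measure.ext_path fun I => ?_
  rw [AEMeasurable.map_map_of_aemeasurable (measurable_restrict_path I).aemeasurable hW,
    AEMeasurable.map_map_of_aemeasurable (measurable_restrict_path I).aemeasurable hW']
  have hadd : Measurable fun (f : I → ℝ) (i : I) => f i + x := by fun_prop
  have h := congrArg (Measure.map fun (f : I → ℝ) (i : I) => f i + x)
    ((hB.hasLaw I).map_eq.trans (hB'.hasLaw I).map_eq.symm)
  rw [AEMeasurable.map_map_of_aemeasurable hadd.aemeasurable (hB.hasLaw I).aemeasurable,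
    AEMeasurable.map_map_of_aemeasurable hadd.aemeasurable (hB'.hasLaw I).aemeasurable] at h
  convert h using 2 <;> ext ω i <;> simp

/-! ### Brownian scaling -/

theorem continuous_energy (T : ℝ) : Continuous (energy T) := by
  refine intervalIntegral.continuous_parametric_intervalIntegral_of_continuous'
    (f := fun (w : C(ℝ≥0, ℝ)) (s : ℝ) => (w s.toNNReal) ^ 2) ?_ 0 T
  simp only [Function.uncurry_def]
  fun_prop

theorem continuous_rescale (q : ℝ) : Continuous (rescale q) := by
  refine ContinuousMap.continuous_of_continuous_uncurry _ ?_
  simp only [Function.uncurry_def, rescale, ContinuousMap.coe_mk]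
  fun_prop

theorem rescale_apply (q : ℝ) (w : C(ℝ≥0, ℝ)) (t : ℝ≥0) :
    rescale q w t = q⁻¹ * w (Real.toNNReal (q ^ 2 * (t : ℝ))) := rfl

/-- Brownian scaling of the energy functional. -/
theorem energy_rescale {q : ℝ} (hq : 0 < q) (T : ℝ) (w : C(ℝ≥0, ℝ)) :
    energy (T / q ^ 2) (rescale q w) = energy T w / q ^ 4 := by
  have hq2 : q ^ 2 ≠ 0 := by positivity
  have h1 : ∀ s : ℝ, (rescale q w s.toNNReal) ^ 2 = (q ^ 2)⁻¹ * (w (q ^ 2 * s).toNNReal) ^ 2 := by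
    intro s
    have : Real.toNNReal (q ^ 2 * (s.toNNReal : ℝ)) = (q ^ 2 * s).toNNReal := by
      rw [Real.toNNReal_mul (by positivity), Real.toNNReal_mul (by positivity),
        Real.toNNReal_coe]
    rw [rescale_apply, this, mul_pow, inv_pow]
  unfold energy
  simp_rw [h1]
  rw [intervalIntegral.integral_const_mul,
    intervalIntegral.integral_comp_mul_left (fun s => (w s.toNNReal) ^ 2) hq2, mul_zero,
    mul_div_cancel₀ _ hq2, smul_eq_mul]
  field_simp

/-- Brownian scaling: the rescaled process is a Brownian motion started at the scaled point. -/
theorem isPreBrownianReal_rescale {Ω : Type*} [MeasurableSpace Ω] {P : Measure Ω} {x q : ℝ}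
    (hq : 0 < q) {W : Ω → C(ℝ≥0, ℝ)} (hB : IsPreBrownianReal (fun t ω => W ω t - x) P) :
    IsPreBrownianReal (fun t ω => rescale q (W ω) t - x / q) P := by
  have hc : (Real.toNNReal (q ^ 2)) ≠ 0 := by
    simpa using hq.ne'
  convert hB.smul hc using 3 with t ω
  rw [rescale_apply, Real.coe_toNNReal _ (by positivity), Real.sqrt_sq hq.le,
    Real.toNNReal_mul (by positivity), Real.toNNReal_coe]
  ring

/-- Conditioning a law transports along a measurable map. -/
theorem map_comp_cond_preimage {Ω E F : Type*} [MeasurableSpace Ω] [MeasurableSpace E]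
    [MeasurableSpace F] {P : Measure Ω} {W : Ω → E} (hW : AEMeasurable W P) {A : Set E}
    (hA : MeasurableSet A) {f : E → F} (hf : Measurable f) :
    (ProbabilityTheory.cond P (W ⁻¹' A)).map (fun ω => f (W ω)) =
      (ProbabilityTheory.cond (P.map W) A).map f := by
  rw [ProbabilityTheory.cond, ProbabilityTheory.cond, Measure.map_apply_of_aemeasurable hW hA,
    Measure.map_smul, Measure.map_smul, Measure.restrict_map_of_aemeasurable hW hA,
    AEMeasurable.map_map_of_aemeasurable hf.aemeasurable hW.restrict]
  rfl

theorem map_cond_rescale_eq {Ω Ω' : Type*} [MeasurableSpace Ω] [MeasurableSpace Ω']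
    {P : Measure Ω} {P' : Measure Ω'} (T : ℝ) {q x : ℝ} (hq : 0 < q)
    {W : Ω → C(ℝ≥0, ℝ)} {W' : Ω' → C(ℝ≥0, ℝ)}
    (hW : IsBrownianFrom x W P) (hW' : IsBrownianFrom (x / q) W' P') :
    (ProbabilityTheory.cond P {ω | energy T (W ω) ≤ q ^ 2 * T}).map
        (fun ω => rescale q (W ω)) =
      (ProbabilityTheory.cond P' {ω | energy (T / q ^ 2) (W' ω) ≤ T / q ^ 2}).map W' := by
  have hr : AEMeasurable (fun ω => rescale q (W ω)) P :=
    (continuous_rescale q).measurable.comp_aemeasurable hW.aemeasurable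
  have hA : MeasurableSet {w | energy (T / q ^ 2) w ≤ T / q ^ 2} :=
    measurableSet_le (continuous_energy _).measurable measurable_const
  have hset : {ω | energy T (W ω) ≤ q ^ 2 * T} =
      (fun ω => rescale q (W ω)) ⁻¹' {w | energy (T / q ^ 2) w ≤ T / q ^ 2} := by
    ext ω
    simp only [mem_ofPred_eq, mem_preimage, energy_rescale hq]
    rw [div_le_div_iff₀ (by positivity) (by positivity)]
    have hq2 : 0 < q ^ 2 := by positivity
    rw [show T * q ^ 4 = (q ^ 2 * T) * q ^ 2 by ring, mul_le_mul_iff_left₀ hq2]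
  have hlaw := map_eq_of_isPreBrownianReal hr
    (isPreBrownianReal_rescale hq hW.isBrownianReal.toIsPreBrownianReal) hW'.aemeasurable
    hW'.isBrownianReal.toIsPreBrownianReal
  rw [hset]
  have h1 := map_comp_cond_preimage hr hA measurable_id
  have h2 := map_comp_cond_preimage hW'.aemeasurable hA measurable_id
  rw [hlaw] at h1
  exact h1.trans h2.symm


/-! ### Small balls -/

/-- The normalised difference of two independent pre-Brownian motions is pre-Brownian. -/
theorem isPreBrownianReal_sub_of_indepFun {Ω : Type*} [MeasurableSpace Ω] {P : Measure Ω}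
    {X Y : ℝ≥0 → Ω → ℝ} (hX : IsPreBrownianReal X P) (hY : IsPreBrownianReal Y P)
    (hXY : IndepFun (fun ω t => X t ω) (fun ω t => Y t ω) P) :
    IsPreBrownianReal (fun t ω => (√2)⁻¹ * (X t ω - Y t ω)) P := by
  have : IsProbabilityMeasure P := hX.isGaussianProcess.isProbabilityMeasure
  have hind : ∀ s t, cov[X s, Y t; P] = 0 := fun s t => by
    have h : IndepFun (X s) (Y t) P := hXY.comp (measurable_pi_apply s) (measurable_pi_apply t)
    exact h.covariance_eq_zero (hX.isGaussianProcess.hasGaussianLaw_eval s).memLp_two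
      (hY.isGaussianProcess.hasGaussianLaw_eval t).memLp_two
  refine IsGaussianProcess.isPreBrownianReal_of_covariance ⟨fun I => ?_⟩ (fun t => ?_)
    fun s t hst => ?_
  · have hI : IndepFun (fun ω => I.restrict (X · ω)) (fun ω => I.restrict (Y · ω)) P :=
      hXY.comp (Finset.measurable_restrict I) (Finset.measurable_restrict I)
    have hg := hI.hasGaussianLaw (hX.isGaussianProcess.hasGaussianLaw I)
      (hY.isGaussianProcess.hasGaussianLaw I)
    exact hg.map ((√2)⁻¹ • (ContinuousLinearMap.fst ℝ (I → ℝ) (I → ℝ) -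
      ContinuousLinearMap.snd ℝ (I → ℝ) (I → ℝ)))
  · rw [integral_const_mul, integral_sub (hX.integrable_eval t) (hY.integrable_eval t),
      hX.integral_eval, hY.integral_eval, sub_zero, mul_zero]
  · have mX t := (hX.isGaussianProcess.hasGaussianLaw_eval t).memLp_two
    have mY t := (hY.isGaussianProcess.hasGaussianLaw_eval t).memLp_two
    rw [covariance_const_mul_left, covariance_const_mul_right,
      covariance_fun_sub_left (Y := Y s) (Z := fun ω => X t ω - Y t ω) (mX s) (mY s)
        ((mX t).sub (mY t)),
      covariance_fun_sub_right (mX s) (mX t) (mY t), covariance_fun_sub_right (mY s) (mX t) (mY t),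
      hX.covariance_fun_eval, hY.covariance_fun_eval, hind, covariance_comm, hind, min_eq_left hst]
    have : (√2)⁻¹ * (√2)⁻¹ = (2 : ℝ)⁻¹ := by
      rw [← mul_inv, Real.mul_self_sqrt (by norm_num)]
    rw [← mul_assoc, this]
    ring

/-- A continuous process stays pre-Brownian when its law is pulled back along a map. -/
theorem isPreBrownianReal_comp {Ω Ω' : Type*} [MeasurableSpace Ω] [MeasurableSpace Ω']
    {P : Measure Ω} {Q : Measure Ω'} {B : Ω → C(ℝ≥0, ℝ)} {Z : Ω' → C(ℝ≥0, ℝ)}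
    (hB : AEMeasurable B P) (hb : IsPreBrownianReal (fun t ω => B ω t) P)
    (hZ : AEMeasurable Z Q) (h : Q.map Z = P.map B) :
    IsPreBrownianReal (fun t ω => Z ω t) Q where
  hasLaw I :=
    { aemeasurable := (measurable_restrict_path I).comp_aemeasurable hZ
      map_eq := by
        rw [← (hb.hasLaw I).map_eq]
        have h1 := AEMeasurable.map_map_of_aemeasurable
          (measurable_restrict_path I).aemeasurable hZ
        have h2 := AEMeasurable.map_map_of_aemeasurable
          (measurable_restrict_path I).aemeasurable hB
        rw [h] at h1
        exact h1.symm.trans h2 }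

/-- Small ball positivity: a Brownian path is uniformly small on `[0,T]` with positive
probability. -/
theorem measure_forall_abs_le_pos {Ω : Type*} [MeasurableSpace Ω] {P : Measure Ω}
    {B : Ω → C(ℝ≥0, ℝ)} (hB : AEMeasurable B P) (hb : IsPreBrownianReal (fun t ω => B ω t) P)
    (T : ℝ≥0) {ε : ℝ} (hε : 0 < ε) : 0 < P {ω | ∀ t ≤ T, |B ω t| ≤ ε} := by
  have : IsProbabilityMeasure P := hb.isGaussianProcess.isProbabilityMeasure
  set μ := P.map B with hμ
  have : IsProbabilityMeasure μ := Measure.isProbabilityMeasure_map hB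
  -- Some path `a` lies in the support of `μ`. Two independent copies both near `a` have a small
  -- difference, and that difference over `√2` again has law `μ`.
  obtain ⟨a, -, ha⟩ := exists_mem_forall_mem_nhdsWithin_pos_measure (μ := μ) (s := univ)
    (by simp)
  simp only [nhdsWithin_univ] at ha
  set U : Set C(ℝ≥0, ℝ) := {w | ∀ t ≤ T, |w t - a t| < ε / 2} with hU
  have hUo : IsOpen U := by
    have h1 : IsOpen {w : C(ℝ≥0, ℝ) | MapsTo w (Icc 0 T) (Metric.ball 0 (ε / 2))} :=
      ContinuousMap.isOpen_setOfPred_mapsTo isCompact_Icc Metric.isOpen_ball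
    convert h1.preimage (continuous_id.sub continuous_const : Continuous fun w => w - a) using 1
    ext w
    simp [hU, MapsTo, Real.norm_eq_abs]
  have hUpos : 0 < μ U := ha U (hUo.mem_nhds (by simp [hU, hε]))
  set Q := μ.prod μ
  let Z : C(ℝ≥0, ℝ) × C(ℝ≥0, ℝ) → C(ℝ≥0, ℝ) := fun p => (√2)⁻¹ • (p.1 - p.2)
  have hZ : Measurable Z := by
    have : Continuous Z := by fun_prop
    exact this.measurable
  have h1 : IsPreBrownianReal (fun t (p : C(ℝ≥0, ℝ) × C(ℝ≥0, ℝ)) => p.1 t) Q :=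
    isPreBrownianReal_comp hB hb measurable_fst.aemeasurable (by simp [Q, hμ])
  have h2 : IsPreBrownianReal (fun t (p : C(ℝ≥0, ℝ) × C(ℝ≥0, ℝ)) => p.2 t) Q :=
    isPreBrownianReal_comp hB hb measurable_snd.aemeasurable (by simp [Q, hμ])
  have hev : Measurable fun (w : C(ℝ≥0, ℝ)) (t : ℝ≥0) => w t :=
    measurable_pi_lambda _ fun t => (continuous_eval_const t).measurable
  have hind : IndepFun (fun (p : C(ℝ≥0, ℝ) × C(ℝ≥0, ℝ)) t => p.1 t) (fun p t => p.2 t) Q :=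
    indepFun_prod hev hev
  have hlaw : Q.map Z = μ := by
    refine map_eq_of_isPreBrownianReal (x := 0) hZ.aemeasurable ?_ hB (by simpa using hb)
    simpa [Z] using isPreBrownianReal_sub_of_indepFun h1 h2 hind
  set S : Set C(ℝ≥0, ℝ) := {w | ∀ t ≤ T, |w t| ≤ ε} with hS
  have hSm : MeasurableSet S := by
    have : IsClosed S := by
      simp only [hS, ofPred_forall]
      exact isClosed_iInter fun t => isClosed_iInter fun _ =>
        isClosed_le (continuous_eval_const t).abs continuous_const
    exact this.measurableSet
  have hsub : U ×ˢ U ⊆ Z ⁻¹' S := by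
    rintro ⟨w, v⟩ ⟨hw, hv⟩ t ht
    have hw := hw t ht
    have hv := hv t ht
    have h3 : |w t - v t| ≤ ε := by
      rw [abs_le]; rw [abs_lt] at hw hv; constructor <;> linarith [hw.1, hw.2, hv.1, hv.2]
    have h4 : (√2)⁻¹ ≤ 1 := inv_le_one_of_one_le₀ (Real.one_le_sqrt.2 (by norm_num))
    have h5 : Z (w, v) t = (√2)⁻¹ * (w t - v t) := rfl
    rw [h5, abs_mul, abs_of_nonneg (by positivity)]
    calc (√2)⁻¹ * |w t - v t| ≤ 1 * ε := by gcongr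
      _ = ε := one_mul ε
  have : 0 < Q (U ×ˢ U) := by
    rw [Measure.prod_prod]
    exact ENNReal.mul_pos hUpos.ne' hUpos.ne'
  have h6 := this.trans_le (measure_mono hsub)
  rw [← Measure.map_apply hZ hSm, hlaw, hμ, Measure.map_apply_of_aemeasurable hB hSm] at h6
  exact h6

/-! ### Steering the path towards 0 -/

/-- Removing from a Brownian motion its projection on the value at `δ` leaves a process
independent of that value. -/
theorem indepFun_sub_proj {Ω : Type*} [MeasurableSpace Ω] {P : Measure Ω} {B : ℝ≥0 → Ω → ℝ}
    (hB : IsPreBrownianReal B P) {δ : ℝ≥0} (hδ : 0 < δ) :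
    IndepFun (B δ) (fun ω t => B t ω - (min t δ / δ : ℝ) * B δ ω) P := by
  classical
  have : IsProbabilityMeasure P := hB.isGaussianProcess.isProbabilityMeasure
  have m t := (hB.isGaussianProcess.hasGaussianLaw_eval t).memLp_two
  have h : IndepFun (fun ω (_ : Unit) => B δ ω)
      (fun ω t => B t ω - (min t δ / δ : ℝ) * B δ ω) P := by
    refine IsGaussianProcess.indepFun_of_covariance_eq_zero (X := fun _ => B δ)
      (Y := fun t ω => B t ω - (min t δ / δ : ℝ) * B δ ω) ?_ (fun _ => hB.aemeasurable δ)
      (fun t => (hB.aemeasurable t).sub ((hB.aemeasurable δ).const_mul _)) ?_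
    · apply hB.isGaussianProcess.of_isGaussianProcess
      rintro (_ | t)
      · exact ⟨{δ},
          { toFun x := x ⟨δ, by simp⟩
            map_add' x y := by simp
            map_smul' c x := by simp }, by simp⟩
      · exact ⟨{δ, t},
          { toFun x := x ⟨t, by simp⟩ - (min t δ / δ : ℝ) * x ⟨δ, by simp⟩
            map_add' x y := by simp; ring
            map_smul' c x := by simp; ring }, by simp⟩
    -- The covariance is `min t δ - (min t δ / δ) * δ = 0`; joint Gaussianity upgrades this to
    -- independence.
    · intro _ t
      rw [covariance_fun_sub_right (m δ) (m t) ((m δ).const_mul _), covariance_const_mul_right,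
        hB.covariance_fun_eval, hB.covariance_fun_eval]
      have : (δ : ℝ) ≠ 0 := by exact_mod_cast hδ.ne'
      simp [min_comm, this]
  exact h.comp (measurable_pi_apply ()) measurable_id

/-- Lebesgue measure is absolutely continuous with respect to a nondegenerate Gaussian. -/
theorem gaussianReal_Icc_pos (m : ℝ) {v : ℝ≥0} (hv : v ≠ 0) {a b : ℝ} (hab : a < b) :
    0 < gaussianReal m v (Icc a b) := by
  refine pos_iff_ne_zero.2 fun h => ?_
  have := gaussianReal_absolutelyContinuous' m hv h
  simp [hab.not_ge] at this

/-- A Brownian motion started at `x` moves close to `0` by time `δ`, and stays there up to time `T`,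
with positive probability. -/
theorem measure_near_zero_pos {Ω : Type*} [MeasurableSpace Ω] {P : Measure Ω} {x : ℝ}
    {W : Ω → C(ℝ≥0, ℝ)} (hW : IsBrownianFrom x W P) {T δ : ℝ≥0} (hδ : 0 < δ) (hδT : δ ≤ T)
    {ε : ℝ} (hε : 0 < ε) :
    0 < P {ω | ∀ t ≤ T, |W ω t| ≤ 3 * ε + |x| ∧ (δ ≤ t → |W ω t| ≤ 3 * ε)} := by
  have hB := hW.isBrownianReal.toIsPreBrownianReal
  set B : ℝ≥0 → Ω → ℝ := fun t ω => W ω t - x with hBdef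
  have hδ' : (0 : ℝ) < δ := hδ
  have hm0 (t : ℝ≥0) : (0 : ℝ) ≤ min t δ / δ := by positivity
  have hm1 (t : ℝ≥0) : (min t δ / δ : ℝ) ≤ 1 := by
    rw [div_le_one hδ']; exact min_le_right _ _
  let d := TopologicalSpace.denseSeq ℝ≥0
  -- Countably many times keep `S` measurable in the product σ-algebra. The strict `< T` makes the
  -- time set open, so the dense times fill it and continuity recovers all `t ≤ T`.
  let S : Set (ℝ≥0 → ℝ) := {f | ∀ n, d n < T → |f (d n)| ≤ 2 * ε}
  have hS : MeasurableSet S := by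
    simp only [S, ofPred_forall]
    refine MeasurableSet.iInter fun n => MeasurableSet.iInter fun _ => ?_
    exact measurableSet_le (measurable_pi_apply (d n)).abs measurable_const
  let R : Ω → ℝ≥0 → ℝ := fun ω t => B t ω - (min t δ / δ : ℝ) * B δ ω
  have hRS : 0 < P (R ⁻¹' S) := by
    have hBm : AEMeasurable (fun ω => W ω - ContinuousMap.const ℝ≥0 x) P :=
      (continuous_id.sub continuous_const : Continuous fun w : C(ℝ≥0, ℝ) =>
        w - ContinuousMap.const ℝ≥0 x).measurable.comp_aemeasurable hW.aemeasurable
    refine (measure_forall_abs_le_pos hBm hB T hε).trans_le (measure_mono fun ω hω n hn => ?_)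
    have h1 : |B (d n) ω| ≤ ε := hω _ hn.le
    have h2 : |B δ ω| ≤ ε := hω _ hδT
    calc |R ω (d n)| ≤ |B (d n) ω| + |(min (d n) δ / δ : ℝ) * B δ ω| := abs_sub _ _
      _ ≤ ε + 1 * ε := by
        rw [abs_mul, abs_of_nonneg (hm0 _)]
        gcongr
        exact hm1 _
      _ = 2 * ε := by ring
  have hI : 0 < P (B δ ⁻¹' Icc (-x - ε) (-x + ε)) := by
    have h := hB.hasLaw_eval δ
    rw [← Measure.map_apply_of_aemeasurable h.aemeasurable measurableSet_Icc, h.map_eq]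
    exact gaussianReal_Icc_pos _ hδ.ne' (by linarith)
  have hind : P (B δ ⁻¹' Icc (-x - ε) (-x + ε) ∩ R ⁻¹' S) = _ :=
    (indepFun_sub_proj hB hδ).measure_inter_preimage_eq_mul _ _ measurableSet_Icc hS
  have hpos : 0 < P (B δ ⁻¹' Icc (-x - ε) (-x + ε) ∩ R ⁻¹' S) := by
    rw [hind]
    exact ENNReal.mul_pos hI.ne' hRS.ne'
  refine hpos.trans_le (measure_mono ?_)
  rintro ω ⟨h1, h2⟩
  have hb : |B δ ω + x| ≤ ε := by
    rw [abs_le]; constructor <;> linarith [h1.1, h1.2]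
  have hcont : Continuous (R ω) := by
    simp only [R, hBdef]
    fun_prop
  have hclosed : IsClosed {t | |R ω t| ≤ 2 * ε} := isClosed_le hcont.abs continuous_const
  have hIic : Iic T ⊆ {t | |R ω t| ≤ 2 * ε} := by
    rw [← closure_Iio' (a := T) ⟨0, hδ.trans_le hδT⟩]
    refine closure_minimal (Subset.trans ((TopologicalSpace.denseRange_denseSeq
      ℝ≥0).open_subset_closure_inter isOpen_Iio) (closure_minimal ?_ hclosed)) hclosed
    rintro _ ⟨hn, n, rfl⟩
    exact h2 n hn
  intro t ht
  have hr : |R ω t| ≤ 2 * ε := hIic ht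
  -- The three terms are at most `2 * ε`, `ε` and `|x|`; the last vanishes once `δ ≤ t`.
  have hW1 : W ω t = R ω t + (min t δ / δ : ℝ) * (B δ ω + x) +
      (1 - (min t δ / δ : ℝ)) * x := by
    simp only [R, hBdef]; ring
  have hp : |(min t δ / δ : ℝ) * (B δ ω + x)| ≤ ε := by
    rw [abs_mul, abs_of_nonneg (hm0 _)]
    calc _ ≤ 1 * ε := by gcongr; exact hm1 _
      _ = ε := one_mul _
  refine ⟨?_, fun hle => ?_⟩
  · have hq : |(1 - (min t δ / δ : ℝ)) * x| ≤ |x| := by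
      rw [abs_mul, abs_of_nonneg (sub_nonneg.2 (hm1 _))]
      exact mul_le_of_le_one_left (abs_nonneg _) (by linarith [hm0 t])
    rw [hW1]
    refine (abs_add_three _ _ _).trans ?_
    linarith
  · have : (min t δ / δ : ℝ) = 1 := by
      rw [min_eq_right (by exact_mod_cast hle), div_self hδ'.ne']
    rw [hW1, this]
    rw [this] at hp
    have := abs_add_le (R ω t) (1 * (B δ ω + x))
    simp only [sub_self, zero_mul, add_zero]
    linarith

/-! ### Positivity and conclusion -/

theorem measure_energy_le_pos {Ω : Type*} [MeasurableSpace Ω] {P : Measure Ω} {x : ℝ}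
    {W : Ω → C(ℝ≥0, ℝ)} (hW : IsBrownianFrom x W P) {T c : ℝ} (hT : 0 < T) (hc : 0 < c) :
    0 < P {ω | energy T (W ω) ≤ c} := by
  obtain ⟨ε, hε, hε'⟩ : ∃ ε : ℝ, 0 < ε ∧ (3 * ε) ^ 2 * T ≤ c / 2 := by
    -- With this `ε` the part after `δ` costs at most `c / 2`; `δ` is then chosen so that the part
    -- before it does too.
    refine ⟨√(c / (18 * T)), by positivity, ?_⟩
    rw [mul_pow, Real.sq_sqrt (by positivity)]
    field_simp
    norm_num
  set K := (3 * ε + |x|) ^ 2 with hK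
  have hK0 : 0 < K := by positivity
  set δ := min T (c / (2 * K)) with hδdef
  have hδ : 0 < δ := by positivity
  have hδT : δ ≤ T := min_le_left _ _
  have hδK : K * δ ≤ c / 2 := by
    calc K * δ ≤ K * (c / (2 * K)) := by gcongr; exact min_le_right _ _
      _ = c / 2 := by field_simp
  refine (measure_near_zero_pos hW (T := T.toNNReal) (δ := δ.toNNReal) (by simpa using hδ)
    (Real.toNNReal_le_toNNReal hδT) hε).trans_le (measure_mono fun ω hω => ?_)
  have hcont : Continuous fun s : ℝ => (W ω s.toNNReal) ^ 2 := by fun_prop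
  have e1 : energy T (W ω) = (∫ s in (0 : ℝ)..δ, (W ω s.toNNReal) ^ 2) +
      ∫ s in δ..T, (W ω s.toNNReal) ^ 2 :=
    (intervalIntegral.integral_add_adjacent_intervals (hcont.intervalIntegrable _ _)
      (hcont.intervalIntegrable _ _)).symm
  have e2 : (∫ s in (0 : ℝ)..δ, (W ω s.toNNReal) ^ 2) ≤ ∫ s in (0 : ℝ)..δ, K := by
    refine intervalIntegral.integral_mono_on hδ.le (hcont.intervalIntegrable _ _)
      (by simp) fun s hs => ?_
    have := (hω s.toNNReal (Real.toNNReal_le_toNNReal (hs.2.trans hδT))).1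
    rw [← sq_abs]
    exact pow_le_pow_left₀ (abs_nonneg _) this 2
  have e3 : (∫ s in δ..T, (W ω s.toNNReal) ^ 2) ≤ ∫ s in δ..T, (3 * ε) ^ 2 := by
    refine intervalIntegral.integral_mono_on hδT (hcont.intervalIntegrable _ _)
      (by simp) fun s hs => ?_
    have := (hω s.toNNReal (Real.toNNReal_le_toNNReal hs.2)).2 (Real.toNNReal_le_toNNReal hs.1)
    rw [← sq_abs]
    exact pow_le_pow_left₀ (abs_nonneg _) this 2
  simp only [intervalIntegral.integral_const, smul_eq_mul] at e2 e3
  have : (T - δ) * (3 * ε) ^ 2 ≤ T * (3 * ε) ^ 2 := by gcongr; linarith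
  change energy T (W ω) ≤ c
  rw [e1]
  linarith

theorem propositionp {Ω Ω' : Type*} [MeasurableSpace Ω] [MeasurableSpace Ω']
    (P : Measure Ω) (P' : Measure Ω') (T q x : ℝ) (hT : 0 < T) (hq : 0 < q)
    (W : Ω → C(ℝ≥0, ℝ)) (W' : Ω' → C(ℝ≥0, ℝ))
    (hW : IsBrownianFrom x W P) (hW' : IsBrownianFrom (x / q) W' P') :
    0 < P {ω | energy T (W ω) ≤ q ^ 2 * T} ∧
    0 < P' {ω | energy (T / q ^ 2) (W' ω) ≤ T / q ^ 2} ∧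
    (ProbabilityTheory.cond P {ω | energy T (W ω) ≤ q ^ 2 * T}).map
        (fun ω => rescale q (W ω)) =
      (ProbabilityTheory.cond P' {ω | energy (T / q ^ 2) (W' ω) ≤ T / q ^ 2}).map W' :=
  ⟨measure_energy_le_pos hW hT (by positivity),
    measure_energy_le_pos hW' (by positivity) (by positivity),
    map_cond_rescale_eq T hq hW hW'⟩
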